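/- There is a Riesz product measure $\mu$ on $[0,1]$ that is continuous (it has no point masses) and is not a Rajchman measure, and there is a sequence of positive numbers $t_k\to 0$, such that for every $f\in L^2(\mathbb R)$ $$\lim_{k\to\infty}\,(C_{t_k}\mu * f)(x)=f(x)\qquad\text{for Lebesgue-a.e. }x\in\mathbb R .$$ Moreover, $\mu$ can be taken to be a Riesz product measure with all coefficients equal to $1$. Here a Riesz product measure with coefficients $(a_m)$ and frequencies $(n_m)$, where $a_m$ are real with $0<|a_m|\le 1$ and $n_m$ are positive integers with $n_{m+1}\ge 3n_m$, is the Borel probability measure on $[0,1]$ (viewed as a measure on $\mathbb R$) that is the weak* limit of the measures $\prod_{m\le k}\bigl(1+a_m\cos(2\pi n_m x)\bigr)\,dx$ on $[0,1]$ as $k\to\infty$, i.e. $\int g\,d\mu=\lim_{k}\int_0^1 g(x)\prod_{m\le k}\bigl(1+a_m\cos(2\pi n_m x)\bigr)\,dx$ for every continuous $g$. A Borel probability measure $\mu$ is Rajchman if $\widehat\mu(j)=\int e^{-2\pi i jx}\,d\mu(x)\to0$ as $|j|\to\infty$, $j\in\mathbb Z$. For $t>0$ the contraction $C_t\mu$ is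 the image of $\mu$ under $x\mapsto tx$, that is $C_t\mu(A)=\mu(A/t)$, and $(\nu*f)(x)=\int f(x-y)\,d\nu(y)$; part of the claim is that for a.e. $x$ the integrals defining $(C_{t_k}\mu*f)(x)$, $k\ge1$, converge absolutely. -/

import Mathlib

open MeasureTheory Filter Topology

noncomputable section

/-- The partial product `∏_{m < k} (1 + a_m cos (2 π n_m x))`. -/
def rieszPartialProduct (a : ℕ → ℝ) (n : ℕ → ℕ) (k : ℕ) (x : ℝ) : ℝ :=
  ∏ m ∈ Finset.range k, (1 + a m * Real.cos (2 * Real.pi * (n m : ℝ) * x))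

/-- `μ` is the Riesz product measure on `[0,1]` with coefficients `a_m` and frequencies `n_m`, where
`0 < |a_m| ≤ 1` and `n_{m+1} / n_m ≥ 3`: the Borel probability measure on `ℝ`, carried by `[0,1]`,
that is the weak-* limit of the measures with the partial products as densities on `[0,1]`. -/
structure IsRieszProductMeasure (a : ℕ → ℝ) (n : ℕ → ℕ) (μ : Measure ℝ) : Prop where
  coeff_ne_zero : ∀ m, a m ≠ 0
  abs_coeff_le_one : ∀ m, |a m| ≤ 1
  freq_pos : ∀ m, 0 < n m
  lacunary : ∀ m, 3 * n m ≤ n (m + 1)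
  isProbabilityMeasure : IsProbabilityMeasure μ
  carried : μ (Set.Icc (0 : ℝ) 1)ᶜ = 0
  tendsto_integral : ∀ g : ℝ → ℝ, Continuous g →
    Tendsto (fun k : ℕ => ∫ x in Set.Icc (0 : ℝ) 1, g x * rieszPartialProduct a n k x)
      atTop (𝓝 (∫ x, g x ∂μ))

/-- The Fourier transform `s ↦ ∫ exp (-2 π i s x) dμ(x)`. -/
def measureFourier (μ : Measure ℝ) (s : ℝ) : ℂ :=
  ∫ x : ℝ, Complex.exp (-2 * (Real.pi : ℂ) * Complex.I * (s : ℂ) * (x : ℂ)) ∂μ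

/-- A Borel probability measure is a Rajchman measure if its Fourier coefficients at the integers
`j` tend to `0` as `|j| → ∞`. -/
def IsRajchman (μ : Measure ℝ) : Prop :=
  IsProbabilityMeasure μ ∧ Tendsto (fun j : ℤ => measureFourier μ (j : ℝ)) cofinite (𝓝 0)

/-- The contraction `C_t μ`, the image of `μ` under `x ↦ t x`; so `C_t μ (A) = μ (A / t)`. -/
def contraction (t : ℝ) (μ : Measure ℝ) : Measure ℝ :=
  μ.map (fun x : ℝ => t * x)

/-- The convolution `(ν ∗ f) x = ∫ f (x - y) dν(y)` of a measure and a function. -/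
def measureConv (ν : Measure ℝ) (f : ℝ → ℂ) (x : ℝ) : ℂ :=
  ∫ y : ℝ, f (x - y) ∂ν

end

/-!
The measure is the Riesz product `μ` with coefficients `1` and frequencies `n m = 16 ^ 4 ^ m`, and
the contraction ratios are `t k = 1 / (n k) ^ 2`.

The convolutions `C_t μ ∗ f` are compared with `C_t λ ∗ f`, where `λ` is Lebesgue measure on `[0,1]`.
The latter converge almost everywhere to `f` by the Lebesgue differentiation theorem
(`ae_tendsto_measureConv_unitMeasure`). For `f ∈ L¹ ∩ L²`, Plancherel's theorem gives
`∑ₖ ‖C_{t k} μ ∗ f - C_{t k} λ ∗ f‖₂² = ∫ ∑ₖ |h (t k ξ)|² |𝓕 f ξ|² dξ`, with `h` the difference of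
the Fourier transforms of `μ` and `λ` (`multiplier`). If `∑ₖ |h (t k ξ)|²` is bounded uniformly in
`ξ`, then the series `∑ₖ |C_{t k} μ ∗ f - C_{t k} λ ∗ f|²` is finite almost everywhere and its terms
tend to `0`. A general `f ∈ L²` is reduced to this case by truncation, since `μ` and `λ` live on
`[0,1]`.

The bound on the series is `exists_tsum_enorm_multiplier_sq_le`. The function `h` does not tend to
`0` at infinity, as `μ` has Fourier coefficient `1 / 2` at each `n m`. But `h s = O(|s|)` near `0`,
and `|h s| ≤ 16 * 2 ^ (-j)` for `4 n j ≤ |s| ≤ n (j + 1) / 4`, so that at infinity `h` is large only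
near the frequencies. The quotients `t k / t l` stay away from the quotients of frequencies, and therefore
`|h (t k ξ)| ≤ 16 * 2 ^ (-k)` for all `k` but at most one, whatever `ξ` is
(`norm_multiplier_le_or`).

All estimates for `μ` come from the identity
`G (k + 1) x s = G k x s + (G k x (s - n k) + G k x (s + n k)) / 2` for the Fourier integrals
`G k x s` of the partial products over `[0,x]` (`partialFourier_succ`). It gives the decay of `h`,
the values of the Fourier transform at the frequencies, and, at `s = 0`, the uniform convergence of
the distribution functions. Their limit is continuous, so the measure that it defines has no point
masses.
-/

/-! ### Plancherel's theorem for integrable functions -/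

section Plancherel
open FourierTransform SchwartzMap
open scoped ContDiff

/-- On `L¹ ∩ L²` the `L²` Fourier transform is given by the Fourier integral. -/
theorem coeFn_fourier_toLp_ae_eq {f : ℝ → ℂ} (hf : Integrable f) (hf2 : MemLp f 2) :
    (𝓕 (hf2.toLp f) : Lp ℂ 2 (volume : Measure ℝ)) =ᵐ[volume] 𝓕 f := by
  have hcont : Continuous (𝓕 f) :=
    VectorFourier.fourierIntegral_continuous Real.continuous_fourierChar
      (by exact continuous_inner) hf
  refine ae_eq_of_integral_contDiff_smul_eq ((Lp.memLp _).locallyIntegrable (by norm_num))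
    hcont.locallyIntegrable fun g hg hgc => ?_
  have hg₁ : HasCompactSupport (fun x => (g x : ℂ)) :=
    hgc.comp_left (g := Complex.ofReal) Complex.ofReal_zero
  have hg₂ : ContDiff ℝ ∞ (fun x => (g x : ℂ)) := Complex.ofRealCLM.contDiff.comp hg
  let φ : 𝓢(ℝ, ℂ) := hg₁.toSchwartzMap hg₂
  have key := congrArg (fun T => T φ) (Lp.fourier_toTemperedDistribution_eq (hf2.toLp f))
  simp only [TemperedDistribution.fourier_apply, Lp.toTemperedDistribution_apply] at key
  calc ∫ x, g x • (𝓕 (hf2.toLp f) : Lp ℂ 2 (volume : Measure ℝ)) x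
      = ∫ x, φ x • (𝓕 (hf2.toLp f) : Lp ℂ 2 (volume : Measure ℝ)) x := by
        refine integral_congr_ae (Eventually.of_forall fun x => ?_)
        simp [φ]
    _ = ∫ x, (𝓕 φ) x • (hf2.toLp f) x := key.symm
    _ = ∫ x, (𝓕 φ) x • f x := by
        refine integral_congr_ae ?_
        filter_upwards [hf2.coeFn_toLp] with x hx
        rw [hx]
    _ = ∫ x, φ x • 𝓕 f x := by
        have := VectorFourier.integral_fourierIntegral_smul_eq_flip (μ := volume) (ν := volume)
          (L := innerₗ ℝ) (f := φ) (g := f) Real.continuous_fourierChar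
          (by exact continuous_inner) φ.integrable hf
        rw [flip_innerₗ] at this
        exact this
    _ = ∫ x, g x • 𝓕 f x := by
        refine integral_congr_ae (Eventually.of_forall fun x => ?_)
        simp [φ]

theorem fourier_sub_apply {f g : ℝ → ℂ} (hf : Integrable f) (hg : Integrable g) (ξ : ℝ) :
    𝓕 (f - g) ξ = 𝓕 f ξ - 𝓕 g ξ := by
  simp only [Real.fourier_real_eq]
  rw [← integral_sub]
  · simp [smul_sub]
  · simpa [mul_comm] using (Real.fourierIntegral_convergent_iff ξ).2 hf
  · simpa [mul_comm] using (Real.fourierIntegral_convergent_iff ξ).2 hg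

/-- **Plancherel's theorem** for the Fourier integral of a function in `L¹ ∩ L²`. -/
theorem lintegral_enorm_fourier_sq {f : ℝ → ℂ} (hf : Integrable f) (hf2 : MemLp f 2) :
    ∫⁻ ξ, ‖𝓕 f ξ‖ₑ ^ 2 = ∫⁻ x, ‖f x‖ₑ ^ 2 := by
  have h (g : ℝ → ℂ) : ∫⁻ x, ‖g x‖ₑ ^ 2 = eLpNorm g 2 volume ^ 2 := by
    simpa using (eLpNorm_nnreal_pow_eq_lintegral (f := g) (μ := volume) (p := 2)
      (by norm_num)).symm
  rw [h, h, ← eLpNorm_congr_ae (coeFn_fourier_toLp_ae_eq hf hf2),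
    ← eLpNorm_congr_ae hf2.coeFn_toLp, ← Lp.enorm_def, ← Lp.enorm_def,
    ← ofReal_norm, ← ofReal_norm, Lp.norm_fourier_eq]

end Plancherel

/-! ### Convolution of a function with a probability measure -/

section Convolution
open FourierTransform

variable {ν : Measure ℝ} {f : ℝ → ℂ}

theorem integrable_comp_sub_prod [IsFiniteMeasure ν] (hf : Integrable f) :
    Integrable (fun p : ℝ × ℝ => f (p.1 - p.2)) (volume.prod ν) := by
  simpa using Integrable.convolution_integrand (ContinuousLinearMap.lsmul ℝ ℝ)
    (integrable_const (1 : ℝ) : Integrable (fun _ => (1 : ℝ)) ν) hf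

theorem ae_integrable_comp_sub [IsFiniteMeasure ν] (hf : Integrable f) :
    ∀ᵐ x, Integrable (fun y => f (x - y)) ν :=
  (integrable_comp_sub_prod hf).prod_right_ae

theorem integrable_measureConv [IsFiniteMeasure ν] (hf : Integrable f) :
    Integrable (measureConv ν f) :=
  (integrable_comp_sub_prod hf).integral_prod_left

theorem fourier_measureConv [IsFiniteMeasure ν] (hf : Integrable f) (ξ : ℝ) :
    𝓕 (measureConv ν f) ξ = measureFourier ν ξ * 𝓕 f ξ := by
  have hint : Integrable (fun p : ℝ × ℝ =>
      Complex.exp (↑(-2 * Real.pi * p.1 * ξ) * Complex.I) • f (p.1 - p.2)) (volume.prod ν) := by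
    refine (integrable_comp_sub_prod (ν := ν) hf).mono ?_ ?_
    · exact (Continuous.aestronglyMeasurable (f := fun p : ℝ × ℝ =>
        Complex.exp (↑(-2 * Real.pi * p.1 * ξ) * Complex.I)) (by fun_prop)).smul
        (integrable_comp_sub_prod (ν := ν) hf).aestronglyMeasurable
    · exact Eventually.of_forall fun p => by
        rw [norm_smul, Complex.norm_exp_ofReal_mul_I, one_mul]
  have h𝓕 (g : ℝ → ℂ) :
      𝓕 g ξ = ∫ x, Complex.exp (↑(-2 * Real.pi * x * ξ) * Complex.I) • g x := by
    rw [Real.fourier_real_eq_integral_exp_smul]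
  calc 𝓕 (measureConv ν f) ξ
      = ∫ x, ∫ y, Complex.exp (↑(-2 * Real.pi * x * ξ) * Complex.I) • f (x - y) ∂ν := by
        rw [h𝓕]; simp_rw [integral_smul]; rfl
    _ = ∫ y, ∫ x, Complex.exp (↑(-2 * Real.pi * x * ξ) * Complex.I) • f (x - y) ∂volume ∂ν :=
        integral_integral_swap hint
    _ = ∫ y, Complex.exp (-2 * (Real.pi : ℂ) * Complex.I * (ξ : ℂ) * (y : ℂ)) * 𝓕 f ξ ∂ν := by
        refine integral_congr_ae (Eventually.of_forall fun y => ?_)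
        dsimp only
        rw [h𝓕, ← integral_const_mul, ← integral_sub_right_eq_self (fun x => Complex.exp
          (-2 * (Real.pi : ℂ) * Complex.I * (ξ : ℂ) * (y : ℂ)) *
            Complex.exp (↑(-2 * Real.pi * x * ξ) * Complex.I) • f x) y]
        refine integral_congr_ae (Eventually.of_forall fun x => ?_)
        simp only [smul_eq_mul, ← mul_assoc, ← Complex.exp_add]
        congr 2
        push_cast; ring
    _ = _ := by rw [integral_mul_const]; rfl

theorem memLp_two_measureConv [IsProbabilityMeasure ν] (hf : Integrable f) (hf2 : MemLp f 2) :
    MemLp (measureConv ν f) 2 := by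
  refine ⟨(integrable_measureConv hf).aestronglyMeasurable, ?_⟩
  have h {α : Type} [MeasurableSpace α] (κ : Measure α) (g : α → ℂ) :
      eLpNorm g 2 κ ^ 2 = ∫⁻ x, ‖g x‖ₑ ^ 2 ∂κ := by
    simpa using (eLpNorm_nnreal_pow_eq_lintegral (f := g) (μ := κ) (p := 2) (by norm_num))
  have hmeas : AEMeasurable (fun p : ℝ × ℝ => ‖f (p.1 - p.2)‖ₑ ^ 2) (volume.prod ν) :=
    (integrable_comp_sub_prod hf).aestronglyMeasurable.enorm.pow_const 2
  have hle : ∫⁻ x, ‖measureConv ν f x‖ₑ ^ 2 ≤ ∫⁻ x, ‖f x‖ₑ ^ 2 := calc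
    _ ≤ ∫⁻ x, ∫⁻ y, ‖f (x - y)‖ₑ ^ 2 ∂ν := by
      refine lintegral_mono_ae ?_
      filter_upwards [ae_integrable_comp_sub (ν := ν) hf] with x hx
      rw [← h]
      gcongr
      calc ‖measureConv ν f x‖ₑ ≤ ∫⁻ y, ‖f (x - y)‖ₑ ∂ν := enorm_integral_le_lintegral_enorm _
        _ = eLpNorm (fun y => f (x - y)) 1 ν := eLpNorm_one_eq_lintegral_enorm.symm
        _ ≤ eLpNorm (fun y => f (x - y)) 2 ν :=
          eLpNorm_le_eLpNorm_of_exponent_le (by norm_num) hx.aestronglyMeasurable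
    _ = ∫⁻ y, ∫⁻ x, ‖f (x - y)‖ₑ ^ 2 ∂volume ∂ν := lintegral_lintegral_swap hmeas
    _ = ∫⁻ y, ∫⁻ x, ‖f x‖ₑ ^ 2 ∂volume ∂ν := by
      congr with y
      exact lintegral_sub_right_eq_self (fun x => ‖f x‖ₑ ^ 2) y
    _ = _ := by simp
  rw [← h, ← h] at hle
  have : eLpNorm f 2 volume ^ 2 < ⊤ := ENNReal.pow_lt_top hf2.2
  by_contra hc
  rw [not_lt, top_le_iff] at hc
  rw [hc] at hle
  simp at hle
  exact absurd hle hf2.2.ne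

theorem isProbabilityMeasure_contraction [IsProbabilityMeasure ν] (t : ℝ) :
    IsProbabilityMeasure (contraction t ν) :=
  Measure.isProbabilityMeasure_map (by fun_prop)

theorem measureFourier_contraction (t ξ : ℝ) :
    measureFourier (contraction t ν) ξ = measureFourier ν (t * ξ) := by
  rw [measureFourier, contraction, integral_map (by fun_prop)
    (Continuous.aestronglyMeasurable (by fun_prop)), measureFourier]
  congr with x
  push_cast
  ring_nf

theorem norm_measureFourier_le_one [IsProbabilityMeasure ν] (s : ℝ) :
    ‖measureFourier ν s‖ ≤ 1 := by
  refine (norm_integral_le_integral_norm _).trans ?_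
  simp [Complex.norm_exp]

theorem continuous_measureFourier [IsProbabilityMeasure ν] : Continuous (measureFourier ν) := by
  refine continuous_of_dominated (bound := fun _ => 1)
    (fun s => Continuous.aestronglyMeasurable (by fun_prop)) ?_ (integrable_const _) ?_
  · intro s
    exact Eventually.of_forall fun x => by simp [Complex.norm_exp]
  · exact Eventually.of_forall fun x => by fun_prop

/-- The Plancherel identity for the difference of two convolution operators. -/
theorem lintegral_enorm_measureConv_sub_sq {ν' : Measure ℝ} [IsProbabilityMeasure ν]
    [IsProbabilityMeasure ν'] (hf : Integrable f) (hf2 : MemLp f 2) :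
    ∫⁻ x, ‖measureConv ν f x - measureConv ν' f x‖ₑ ^ 2 =
      ∫⁻ ξ, ‖measureFourier ν ξ - measureFourier ν' ξ‖ₑ ^ 2 * ‖𝓕 f ξ‖ₑ ^ 2 := by
  have h := lintegral_enorm_fourier_sq
    ((integrable_measureConv (ν := ν) hf).sub (integrable_measureConv (ν := ν') hf))
    ((memLp_two_measureConv (ν := ν) hf hf2).sub (memLp_two_measureConv (ν := ν') hf hf2))
  simp only [Pi.sub_apply] at h
  rw [← h]
  congr with ξ
  rw [← mul_pow, ← enorm_mul, sub_mul, ← fourier_measureConv hf, ← fourier_measureConv hf,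
    fourier_sub_apply (integrable_measureConv hf) (integrable_measureConv hf)]

end Convolution

/-! ### Fourier integrals of the partial products -/

section PartialProducts

/-- The sum `n 0 + ⋯ + n (k - 1)`: the degree of the `k`-th partial product as a trigonometric
polynomial. -/
noncomputable def freqSum (n : ℕ → ℕ) (k : ℕ) : ℝ := ∑ m ∈ Finset.range k, (n m : ℝ)

/-- The Fourier integral `∫_0^x P_k(y) exp (-2 π i s y) dy` of the `k`-th partial product with
coefficients `1`. At `s = 0` it is the distribution function of the density `P_k`, and at `x = 1`
the Fourier transform of that density on `[0,1]`. -/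
noncomputable def partialFourier (n : ℕ → ℕ) (k : ℕ) (x s : ℝ) : ℂ :=
  ∫ y in (0 : ℝ)..x, (rieszPartialProduct (fun _ => 1) n k y : ℂ) *
    Complex.exp (-2 * (Real.pi : ℂ) * Complex.I * (s : ℂ) * (y : ℂ))

variable {n : ℕ → ℕ}

theorem freqSum_succ (k : ℕ) : freqSum n (k + 1) = freqSum n k + n k :=
  Finset.sum_range_succ _ _

theorem freqSum_nonneg (k : ℕ) : 0 ≤ freqSum n k :=
  Finset.sum_nonneg fun _ _ => Nat.cast_nonneg _

theorem le_freqSum {m k : ℕ} (h : m < k) : (n m : ℝ) ≤ freqSum n k :=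
  Finset.single_le_sum (f := fun m => (n m : ℝ)) (fun _ _ => Nat.cast_nonneg _)
    (Finset.mem_range.2 h)

theorem continuous_rieszPartialProduct (a : ℕ → ℝ) (k : ℕ) :
    Continuous (rieszPartialProduct a n k) := by
  unfold rieszPartialProduct
  fun_prop

theorem rieszPartialProduct_nonneg (k : ℕ) (x : ℝ) :
    0 ≤ rieszPartialProduct (fun _ => 1) n k x :=
  Finset.prod_nonneg fun m _ => by
    have := Real.neg_one_le_cos (2 * Real.pi * (n m : ℝ) * x)
    linarith

theorem rieszPartialProduct_succ (k : ℕ) (x : ℝ) :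
    rieszPartialProduct (fun _ => 1) n (k + 1) x =
      rieszPartialProduct (fun _ => 1) n k x * (1 + Real.cos (2 * Real.pi * (n k : ℝ) * x)) := by
  simp [rieszPartialProduct, Finset.prod_range_succ]

theorem continuous_partialFourier_integrand (k : ℕ) (s : ℝ) :
    Continuous fun y : ℝ => (rieszPartialProduct (fun _ => 1) n k y : ℂ) *
      Complex.exp (-2 * (Real.pi : ℂ) * Complex.I * (s : ℂ) * (y : ℂ)) :=
  (Complex.continuous_ofReal.comp (continuous_rieszPartialProduct _ k)).mul (by fun_prop)

theorem partialFourier_succ (k : ℕ) (x s : ℝ) :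
    partialFourier n (k + 1) x s = partialFourier n k x s +
      (1 / 2 * partialFourier n k x (s - n k) + 1 / 2 * partialFourier n k x (s + n k)) := by
  have hi (s : ℝ) := (continuous_partialFourier_integrand (n := n) k s).intervalIntegrable
    (μ := volume) 0 x
  simp only [partialFourier]
  rw [← intervalIntegral.integral_const_mul, ← intervalIntegral.integral_const_mul,
    ← intervalIntegral.integral_add ((hi _).const_mul _) ((hi _).const_mul _),
    ← intervalIntegral.integral_add (hi _) (((hi _).const_mul _).add ((hi _).const_mul _))]
  refine intervalIntegral.integral_congr fun y _ => ?_
  have e1 : Complex.exp (-2 * (Real.pi : ℂ) * Complex.I * ((s - n k : ℝ) : ℂ) * (y : ℂ)) =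
      Complex.exp (-2 * (Real.pi : ℂ) * Complex.I * (s : ℂ) * (y : ℂ)) *
        Complex.exp (2 * Real.pi * n k * y * Complex.I) := by
    rw [← Complex.exp_add]; congr 1; push_cast; ring
  have e2 : Complex.exp (-2 * (Real.pi : ℂ) * Complex.I * ((s + n k : ℝ) : ℂ) * (y : ℂ)) =
      Complex.exp (-2 * (Real.pi : ℂ) * Complex.I * (s : ℂ) * (y : ℂ)) *
        Complex.exp (-(2 * Real.pi * n k * y) * Complex.I) := by
    rw [← Complex.exp_add]; congr 1; push_cast; ring
  simp only [rieszPartialProduct_succ, e1, e2]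
  push_cast
  rw [Complex.cos]
  ring

theorem partialFourier_zero (x : ℝ) {s : ℝ} (hs : s ≠ 0) :
    partialFourier n 0 x s =
      (Complex.exp (-2 * (Real.pi : ℂ) * Complex.I * (s : ℂ) * (x : ℂ)) - 1) /
        (-2 * (Real.pi : ℂ) * Complex.I * (s : ℂ)) := by
  have hc : -2 * (Real.pi : ℂ) * Complex.I * (s : ℂ) ≠ 0 := by
    simp [hs, Real.pi_ne_zero]
  simpa [partialFourier, rieszPartialProduct] using
    integral_exp_mul_complex (a := (0 : ℝ)) (b := x) hc

theorem norm_partialFourier_zero_le (x : ℝ) {s : ℝ} (hs : s ≠ 0) :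
    ‖partialFourier n 0 x s‖ ≤ 1 / |s| := by
  have h1 : ‖Complex.exp (-2 * (Real.pi : ℂ) * Complex.I * (s : ℂ) * (x : ℂ)) - 1‖ ≤ 2 := by
    refine (norm_sub_le _ _).trans ?_
    simp [Complex.norm_exp]
    norm_num
  have hs' : 0 < |s| := abs_pos.2 hs
  rw [partialFourier_zero x hs, norm_div, div_le_div_iff₀ (by simp [hs, Real.pi_ne_zero]) hs']
  have : ‖-2 * (Real.pi : ℂ) * Complex.I * (s : ℂ)‖ = 2 * Real.pi * |s| := by
    simp [abs_of_pos Real.pi_pos]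
  rw [this]
  nlinarith [Real.pi_gt_three]

/-- Beyond its degree, the Fourier integral of a partial product decays: the `k`-th product is an
average with total weight `2 ^ k` of characters of frequency at most `freqSum n k`. -/
theorem norm_partialFourier_le (k : ℕ) (x : ℝ) {s : ℝ} (hs : freqSum n k < |s|) :
    ‖partialFourier n k x s‖ ≤ 2 ^ k / (|s| - freqSum n k) := by
  induction k generalizing s with
  | zero =>
    have hs0 : s ≠ 0 := by
      rintro rfl
      simp [freqSum] at hs
    simpa [freqSum] using norm_partialFourier_zero_le x hs0
  | succ k ih =>
    rw [freqSum_succ] at hs ⊢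
    have hn : (0 : ℝ) ≤ n k := Nat.cast_nonneg _
    have h1 : |s| - n k ≤ |s - n k| := by
      simpa [abs_of_nonneg hn] using abs_sub_abs_le_abs_sub s (n k)
    have h2 : |s| - n k ≤ |s + n k| := by
      simpa [abs_of_nonneg hn] using abs_sub_abs_le_abs_sub s (-(n k : ℝ))
    have key {r : ℝ} (hr : |s| - n k ≤ |r|) :
        ‖partialFourier n k x r‖ ≤ 2 ^ k / (|s| - (freqSum n k + n k)) := by
      refine (ih (by linarith)).trans ?_
      exact div_le_div_of_nonneg_left (by positivity) (by linarith) (by linarith)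
    have k0 := key (r := s) (by linarith)
    have k1 := key h1
    have k2 := key h2
    rw [partialFourier_succ]
    refine (norm_add_le _ _).trans ?_
    refine (add_le_add_right (norm_add_le _ _) _).trans ?_
    simp only [norm_mul]
    have : ‖(1 / 2 : ℂ)‖ = 1 / 2 := by norm_num
    rw [this, pow_succ, mul_comm ((2 : ℝ) ^ k), mul_div_assoc]
    linarith

theorem partialFourier_one_intCast_eq_zero (k : ℕ) {j : ℤ} (hj : freqSum n k < |(j : ℝ)|) :
    partialFourier n k 1 j = 0 := by
  induction k generalizing j with
  | zero =>
    have hj0 : (j : ℝ) ≠ 0 := by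
      intro h
      simp [freqSum, h] at hj
    rw [partialFourier_zero 1 hj0]
    have : Complex.exp (-2 * (Real.pi : ℂ) * Complex.I * ((j : ℝ) : ℂ) * ((1 : ℝ) : ℂ)) = 1 := by
      rw [Complex.exp_eq_one_iff]
      exact ⟨-j, by push_cast; ring⟩
    rw [this]
    simp
  | succ k ih =>
    rw [freqSum_succ] at hj
    have hn : (0 : ℝ) ≤ n k := Nat.cast_nonneg _
    have h1 : |(j : ℝ)| - n k ≤ |(j : ℝ) - n k| := by
      simpa [abs_of_nonneg hn] using abs_sub_abs_le_abs_sub (j : ℝ) (n k)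
    have h2 : |(j : ℝ)| - n k ≤ |(j : ℝ) + n k| := by
      simpa [abs_of_nonneg hn] using abs_sub_abs_le_abs_sub (j : ℝ) (-(n k : ℝ))
    have e1 := ih (j := j - n k) (by push_cast; linarith)
    have e2 := ih (j := j + n k) (by push_cast; linarith)
    push_cast at e1 e2
    rw [partialFourier_succ, ih (by linarith), e1, e2]
    simp

theorem partialFourier_one_zero (hn : ∀ k, freqSum n k < n k) (k : ℕ) :
    partialFourier n k 1 0 = 1 := by
  induction k with
  | zero => simp [partialFourier, rieszPartialProduct]
  | succ k ih =>
    have e1 := partialFourier_one_intCast_eq_zero (n := n) k (j := -(n k : ℤ)) (by simpa using hn k)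
    have e2 := partialFourier_one_intCast_eq_zero (n := n) k (j := (n k : ℤ)) (by simpa using hn k)
    push_cast at e1 e2
    rw [partialFourier_succ, zero_sub, zero_add, e1, e2, ih]
    simp

theorem norm_partialFourier_succ_sub_le (k : ℕ) (x : ℝ) {s : ℝ}
    (hs : |s| + freqSum n k < n k) :
    ‖partialFourier n (k + 1) x s - partialFourier n k x s‖ ≤
      2 ^ k / (n k - |s| - freqSum n k) := by
  have hn : (0 : ℝ) ≤ n k := Nat.cast_nonneg _
  have key {r : ℝ} (hr : n k - |s| ≤ |r|) :
      ‖partialFourier n k x r‖ ≤ 2 ^ k / (n k - |s| - freqSum n k) := by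
    refine (norm_partialFourier_le k x (by linarith)).trans ?_
    exact div_le_div_of_nonneg_left (by positivity) (by linarith) (by linarith)
  have k1 := key (r := s - n k) (by
    simpa [abs_of_nonneg hn, abs_sub_comm] using abs_sub_abs_le_abs_sub (n k : ℝ) s)
  have k2 := key (r := s + n k) (by
    simpa [abs_of_nonneg hn, add_comm] using abs_sub_abs_le_abs_sub (n k : ℝ) (-s))
  rw [partialFourier_succ, add_sub_cancel_left]
  refine (norm_add_le _ _).trans ?_
  simp only [norm_mul]
  have : ‖(1 / 2 : ℂ)‖ = 1 / 2 := by norm_num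
  rw [this]
  linarith

/-- The Fourier coefficient of a partial product at one of its frequencies is `1 / 2`. -/
theorem partialFourier_one_freq (hn : ∀ k, 4 * freqSum n k ≤ n k) (hpos : ∀ k, 0 < n k)
    (m k : ℕ) : partialFourier n (m + 1 + k) 1 (n m) = 1 / 2 := by
  have hpos' (k : ℕ) : (0 : ℝ) < n k := Nat.cast_pos.2 (hpos k)
  have hlt (k : ℕ) : freqSum n k < n k := by
    linarith [hn k, freqSum_nonneg (n := n) k, hpos' k]
  induction k with
  | zero =>
    have e1 := partialFourier_one_intCast_eq_zero (n := n) m (j := (n m : ℤ)) (by simpa using hlt m)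
    have e2 := partialFourier_one_intCast_eq_zero (n := n) m (j := (n m : ℤ) + n m) (by
      push_cast
      rw [abs_of_pos (by linarith [hpos' m])]
      linarith [hlt m, hpos' m])
    push_cast at e1 e2
    rw [add_zero, partialFourier_succ, e1, e2, sub_self, partialFourier_one_zero hlt]
    simp
  | succ k ih =>
    have hm : (n m : ℝ) ≤ freqSum n (m + 1 + k) := le_freqSum (by omega)
    have h4 := hn (m + 1 + k)
    have hp := hpos' (m + 1 + k)
    have hp' := hpos' m
    have e1 := partialFourier_one_intCast_eq_zero (n := n) (m + 1 + k)
      (j := (n m : ℤ) - n (m + 1 + k)) (by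
        push_cast
        rw [abs_of_neg (by linarith)]
        linarith)
    have e2 := partialFourier_one_intCast_eq_zero (n := n) (m + 1 + k)
      (j := (n m : ℤ) + n (m + 1 + k)) (by
        push_cast
        rw [abs_of_pos (by linarith)]
        linarith)
    push_cast at e1 e2
    rw [← add_assoc, partialFourier_succ, ih, e1, e2]
    simp

end PartialProducts

/-! ### The Riesz product measure -/

section Limit

/-- The frequencies `16 ^ 4 ^ m`, each of which is the fourth power of the preceding one. -/
def rieszFreq (m : ℕ) : ℕ := 16 ^ 4 ^ m

theorem rieszFreq_succ (m : ℕ) : rieszFreq (m + 1) = rieszFreq m ^ 4 := by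
  simp [rieszFreq, pow_succ, pow_mul]

theorem rieszFreq_pos (m : ℕ) : 0 < rieszFreq m := by
  simp [rieszFreq]

theorem pow_succ_le_rieszFreq (m : ℕ) : 16 ^ (m + 1) ≤ rieszFreq m :=
  Nat.pow_le_pow_right (by norm_num) (Nat.lt_pow_self (by norm_num))

theorem rieszFreq_strictMono : StrictMono rieszFreq := fun _ _ h =>
  Nat.pow_lt_pow_right (by norm_num) (Nat.pow_lt_pow_right (by norm_num) h)

theorem sixteen_le_rieszFreq (m : ℕ) : (16 : ℝ) ≤ rieszFreq m := by
  have h : 16 ^ 1 ≤ rieszFreq m :=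
    (Nat.pow_le_pow_right (by norm_num) (by omega)).trans (pow_succ_le_rieszFreq m)
  exact_mod_cast h

theorem four_mul_freqSum_le (k : ℕ) : 4 * freqSum rieszFreq k ≤ rieszFreq k := by
  induction k with
  | zero => simp [freqSum]
  | succ k ih =>
    have h := sixteen_le_rieszFreq k
    have h2 : 16 * (rieszFreq k : ℝ) ≤ rieszFreq k ^ 4 := by 
      nlinarith [pow_le_pow_left₀ (by norm_num) h 3]
    rw [freqSum_succ, rieszFreq_succ]
    push_cast
    linarith

theorem freqSum_rieszFreq_lt (k : ℕ) : freqSum rieszFreq k < rieszFreq k := by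
  linarith [four_mul_freqSum_le k, freqSum_nonneg (n := rieszFreq) k, sixteen_le_rieszFreq k]

theorem dist_partialFourier_succ_le (x : ℝ) {s : ℝ} {k : ℕ} (hs : 4 * |s| ≤ rieszFreq k) :
    dist (partialFourier rieszFreq k x s) (partialFourier rieszFreq (k + 1) x s) ≤
      1 / 4 * (1 / 8) ^ k := by
  have hn := sixteen_le_rieszFreq k
  have h4 := four_mul_freqSum_le k
  rw [dist_comm, dist_eq_norm]
  refine (norm_partialFourier_succ_sub_le k x (by linarith)).trans ?_
  have hp : (16 : ℝ) ^ (k + 1) ≤ rieszFreq k := by exact_mod_cast pow_succ_le_rieszFreq k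
  calc (2 : ℝ) ^ k / (rieszFreq k - |s| - freqSum rieszFreq k)
      ≤ 2 ^ k / (4 * 16 ^ k) :=
        div_le_div_of_nonneg_left (by positivity) (by positivity) (by
          rw [pow_succ] at hp
          linarith)
    _ = 1 / 4 * (1 / 8) ^ k := by
        rw [show (16 : ℝ) = 2 * 8 by norm_num, mul_pow, div_pow, one_pow]
        field_simp

/-- The distribution function of the `k`-th partial product. -/
noncomputable def partialCDF (k : ℕ) (x : ℝ) : ℝ :=
  ∫ y in (0 : ℝ)..x, rieszPartialProduct (fun _ => 1) rieszFreq k y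

theorem partialFourier_apply_zero (k : ℕ) (x : ℝ) :
    partialFourier rieszFreq k x 0 = partialCDF k x := by
  simp [partialFourier, partialCDF, intervalIntegral.integral_ofReal]

theorem partialCDF_sub (k : ℕ) (x y : ℝ) :
    partialCDF k y - partialCDF k x =
      ∫ z in x..y, rieszPartialProduct (fun _ => 1) rieszFreq k z := by
  have h (a b : ℝ) := (continuous_rieszPartialProduct (n := rieszFreq) (fun _ => 1)
    k).intervalIntegrable (μ := volume) a b
  exact intervalIntegral.integral_interval_sub_left (h _ _) (h _ _)

theorem monotone_partialCDF (k : ℕ) : Monotone (partialCDF k) := fun x y h => by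
  rw [← sub_nonneg, partialCDF_sub]
  exact intervalIntegral.integral_nonneg h fun z _ => rieszPartialProduct_nonneg k z

theorem partialCDF_one (k : ℕ) : partialCDF k 1 = 1 := by
  have h := partialFourier_one_zero freqSum_rieszFreq_lt k
  rw [partialFourier_apply_zero] at h
  exact_mod_cast h

theorem dist_partialCDF_succ_le (k : ℕ) (x : ℝ) :
    dist (partialCDF k x) (partialCDF (k + 1) x) ≤ 1 / 4 * (1 / 8) ^ k := by
  have h := dist_partialFourier_succ_le x (s := 0) (k := k) (by simp)
  rwa [partialFourier_apply_zero, partialFourier_apply_zero, Complex.dist_of_im_eq (by simp),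
    Complex.ofReal_re, Complex.ofReal_re] at h

/-- The distribution function of the Riesz product, before restriction to `[0,1]`. -/
noncomputable def limitCDF (x : ℝ) : ℝ := limUnder atTop fun k => partialCDF k x

theorem tendsto_partialCDF (x : ℝ) :
    Tendsto (fun k => partialCDF k x) atTop (𝓝 (limitCDF x)) :=
  (cauchySeq_of_le_geometric (1 / 8) (1 / 4) (by norm_num)
    fun k => dist_partialCDF_succ_le k x).tendsto_limUnder

/-- The distribution functions converge uniformly, so that the limit has no jumps. -/
theorem continuous_limitCDF : Continuous limitCDF := by
  have hu : TendstoUniformly partialCDF limitCDF atTop := by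
    rw [Metric.tendstoUniformly_iff]
    intro ε hε
    have h0 : Tendsto (fun k : ℕ => (1 / 4 : ℝ) * (1 / 8) ^ k / (1 - 1 / 8)) atTop (𝓝 0) := by
      simpa using ((tendsto_pow_atTop_nhds_zero_of_lt_one (r := (1 / 8 : ℝ)) (by norm_num)
        (by norm_num)).const_mul (1 / 4 : ℝ)).div_const (1 - 1 / 8)
    filter_upwards [h0.eventually_lt_const hε] with k hk x
    rw [dist_comm]
    exact (dist_le_of_le_geometric_of_tendsto (1 / 8) (1 / 4) (by norm_num)
      (fun k => dist_partialCDF_succ_le k x) (tendsto_partialCDF x) k).trans_lt hk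
  refine hu.continuous (Eventually.of_forall fun k => ?_).frequently
  exact intervalIntegral.continuous_primitive (fun a b =>
    (continuous_rieszPartialProduct _ k).intervalIntegrable a b) 0

theorem monotone_limitCDF : Monotone limitCDF := fun x y h =>
  le_of_tendsto_of_tendsto' (tendsto_partialCDF x) (tendsto_partialCDF y)
    fun k => monotone_partialCDF k h

theorem limitCDF_zero : limitCDF 0 = 0 :=
  tendsto_nhds_unique (tendsto_partialCDF 0) (by simp [partialCDF])

theorem limitCDF_one : limitCDF 1 = 1 :=
  tendsto_nhds_unique (tendsto_partialCDF 1) (by simp [partialCDF_one])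

/-- `limitCDF` as a Stieltjes function. -/
noncomputable def limitStieltjes : StieltjesFunction ℝ where
  toFun := limitCDF
  mono' := monotone_limitCDF
  right_continuous' _ := continuous_limitCDF.continuousWithinAt

/-- The Riesz product measure with coefficients `1` and frequencies `rieszFreq`. -/
noncomputable def rieszMeasure : Measure ℝ :=
  limitStieltjes.measure.restrict (Set.Ioc 0 1)

theorem rieszMeasure_Ioc (a b : ℝ) :
    rieszMeasure (Set.Ioc a b) = ENNReal.ofReal (limitCDF (b ⊓ 1) - limitCDF (a ⊔ 0)) := by
  rw [rieszMeasure, Measure.restrict_apply measurableSet_Ioc, Set.Ioc_inter_Ioc,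
    StieltjesFunction.measure_Ioc]
  rfl

instance isProbabilityMeasure_rieszMeasure : IsProbabilityMeasure rieszMeasure := by
  refine ⟨?_⟩
  rw [rieszMeasure, Measure.restrict_apply_univ, StieltjesFunction.measure_Ioc]
  change ENNReal.ofReal (limitCDF 1 - limitCDF 0) = 1
  simp [limitCDF_zero, limitCDF_one]

theorem rieszMeasure_singleton (x : ℝ) : rieszMeasure {x} = 0 := by
  refine le_antisymm ((Measure.restrict_apply_le _ _).trans ?_) zero_le
  rw [StieltjesFunction.measure_singleton]
  have : Function.leftLim limitStieltjes x = limitStieltjes x :=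
    continuous_limitCDF.continuousAt.continuousWithinAt.leftLim_eq
  simp [this]

theorem rieszMeasure_compl_Icc : rieszMeasure (Set.Icc (0 : ℝ) 1)ᶜ = 0 := by
  rw [rieszMeasure, Measure.restrict_apply measurableSet_Icc.compl]
  have : (Set.Icc (0 : ℝ) 1)ᶜ ∩ Set.Ioc 0 1 = ∅ := by
    ext x; simp only [Set.mem_inter_iff, Set.mem_compl_iff, Set.mem_Icc, Set.mem_Ioc,
      Set.mem_empty_iff_false, iff_false]
    exact fun h => h.1 ⟨h.2.1.le, h.2.2⟩
  simp [this]

/-- The measure on `[0,1]` with the `k`-th partial product as density. -/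
noncomputable def partialMeasure (k : ℕ) : Measure ℝ :=
  (volume.restrict (Set.Ioc (0 : ℝ) 1)).withDensity fun x =>
    ENNReal.ofReal (rieszPartialProduct (fun _ => 1) rieszFreq k x)

theorem partialMeasure_Ioc (k : ℕ) (a b : ℝ) :
    partialMeasure k (Set.Ioc a b) =
      ENNReal.ofReal (partialCDF k (b ⊓ 1) - partialCDF k (a ⊔ 0)) := by
  rw [partialMeasure, withDensity_apply _ measurableSet_Ioc,
    Measure.restrict_restrict measurableSet_Ioc, Set.Ioc_inter_Ioc]
  rcases le_total (a ⊔ 0) (b ⊓ 1) with h | h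
  · rw [partialCDF_sub, intervalIntegral.integral_of_le h, ofReal_integral_eq_lintegral_ofReal]
    · exact ((continuous_rieszPartialProduct _ k).integrableOn_Icc).mono_set Set.Ioc_subset_Icc_self
    · exact Eventually.of_forall fun x => rieszPartialProduct_nonneg k x
  · rw [Set.Ioc_eq_empty h.not_gt, ENNReal.ofReal_of_nonpos]
    · simp
    · linarith [monotone_partialCDF k h]

instance isProbabilityMeasure_partialMeasure (k : ℕ) : IsProbabilityMeasure (partialMeasure k) := by
  have h := partialMeasure_Ioc k 0 1
  refine ⟨?_⟩
  have hu : partialMeasure k Set.univ = partialMeasure k (Set.Ioc 0 1) := by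
    simp [partialMeasure, withDensity_apply _ measurableSet_Ioc]
  rw [hu, h, inf_idem, sup_idem, partialCDF_one]
  simp [partialCDF]

theorem integral_partialMeasure (k : ℕ) (g : ℝ → ℝ) :
    ∫ x, g x ∂(partialMeasure k) =
      ∫ x in Set.Icc (0 : ℝ) 1, g x * rieszPartialProduct (fun _ => 1) rieszFreq k x := by
  rw [partialMeasure, integral_withDensity_eq_integral_toReal_smul
    (continuous_rieszPartialProduct _ k).measurable.ennreal_ofReal
    (Eventually.of_forall fun _ => ENNReal.ofReal_lt_top), integral_Icc_eq_integral_Ioc]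
  refine integral_congr_ae (Eventually.of_forall fun x => ?_)
  simp [ENNReal.toReal_ofReal (rieszPartialProduct_nonneg k x), mul_comm]

/-- Convergence of the distribution functions gives weak convergence of the measures. -/
theorem tendsto_partialMeasure :
    Tendsto (β := ProbabilityMeasure ℝ) (fun k => ⟨partialMeasure k, inferInstance⟩) atTop
      (nhds (X := ProbabilityMeasure ℝ) ⟨rieszMeasure, inferInstance⟩) := by
  have hpi : IsPiSystem (Set.range fun p : ℝ × ℝ => Set.Ioc p.1 p.2) := by
    rintro _ ⟨p, rfl⟩ _ ⟨q, rfl⟩ _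
    exact ⟨(p.1 ⊔ q.1, p.2 ⊓ q.2), Set.Ioc_inter_Ioc.symm⟩
  refine hpi.tendsto_probabilityMeasure_of_tendsto_of_mem ?_ ?_ ?_
  · rintro _ ⟨p, rfl⟩
    exact measurableSet_Ioc
  · intro u hu x hx
    obtain ⟨ε, hε, hball⟩ := Metric.isOpen_iff.1 hu x hx
    refine ⟨_, ⟨(x - ε / 2, x + ε / 2), rfl⟩, Ioc_mem_nhds (by linarith) (by linarith), ?_⟩
    refine fun y hy => hball ?_
    rw [Metric.mem_ball, Real.dist_eq, abs_lt]
    constructor <;> linarith [hy.1, hy.2]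
  · rintro _ ⟨p, rfl⟩
    refine (ENNReal.tendsto_toNNReal (measure_ne_top rieszMeasure _)).comp ?_
    change Tendsto (fun k => partialMeasure k (Set.Ioc p.1 p.2)) atTop
      (𝓝 (rieszMeasure (Set.Ioc p.1 p.2)))
    simp only [partialMeasure_Ioc, rieszMeasure_Ioc]
    exact ENNReal.tendsto_ofReal ((tendsto_partialCDF _).sub (tendsto_partialCDF _))

theorem tendsto_integral_rieszPartialProduct {g : ℝ → ℝ} (hg : Continuous g) :
    Tendsto (fun k : ℕ => ∫ x in Set.Icc (0 : ℝ) 1,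
      g x * rieszPartialProduct (fun _ => 1) rieszFreq k x) atTop (𝓝 (∫ x, g x ∂rieszMeasure)) := by
  -- A continuous function is bounded on `[0,1]`, so it may be replaced by a bounded one.
  let γ : BoundedContinuousFunction ℝ ℝ :=
    (BoundedContinuousFunction.mkOfCompact ⟨fun x : Set.Icc (0 : ℝ) 1 => g x, by fun_prop⟩).compContinuous
      ⟨Set.projIcc 0 1 zero_le_one, continuous_projIcc⟩
  have hγ {x : ℝ} (hx : x ∈ Set.Icc (0 : ℝ) 1) : γ x = g x := by
    simp [γ, Set.projIcc_of_mem zero_le_one hx]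
  have h := ProbabilityMeasure.tendsto_iff_forall_integral_tendsto.1 tendsto_partialMeasure γ
  have e1 : ∫ x, γ x ∂rieszMeasure = ∫ x, g x ∂rieszMeasure := by
    refine integral_congr_ae ?_
    have : ∀ᵐ x ∂rieszMeasure, x ∈ Set.Icc (0 : ℝ) 1 := rieszMeasure_compl_Icc
    filter_upwards [this] with x hx using hγ hx
  simp only [ProbabilityMeasure.coe_mk, integral_partialMeasure, e1] at h
  refine h.congr fun k => setIntegral_congr_fun measurableSet_Icc fun x hx => ?_
  simp only [hγ hx]

theorem isRieszProductMeasure_rieszMeasure :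
    IsRieszProductMeasure (fun _ => 1) rieszFreq rieszMeasure where
  coeff_ne_zero _ := one_ne_zero
  abs_coeff_le_one _ := by simp
  freq_pos := rieszFreq_pos
  lacunary m := by
    have h : (16 : ℕ) ≤ rieszFreq m := by exact_mod_cast sixteen_le_rieszFreq m
    have h3 : 16 ^ 3 ≤ rieszFreq m ^ 3 := Nat.pow_le_pow_left h 3
    rw [rieszFreq_succ, pow_succ]
    exact Nat.mul_le_mul_right _ (by omega)
  isProbabilityMeasure := inferInstance
  carried := rieszMeasure_compl_Icc
  tendsto_integral _ hg := tendsto_integral_rieszPartialProduct hg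

theorem tendsto_partialFourier_one (s : ℝ) :
    Tendsto (fun k => partialFourier rieszFreq k 1 s) atTop (𝓝 (measureFourier rieszMeasure s)) := by
  let e : ℝ → ℂ := fun x => Complex.exp (-2 * (Real.pi : ℂ) * Complex.I * (s : ℂ) * (x : ℂ))
  have he : Continuous e := by fun_prop
  have hint : Integrable e rieszMeasure :=
    Integrable.of_bound he.aestronglyMeasurable 1 (Eventually.of_forall fun x => by
      simp [e, Complex.norm_exp])
  have hk (k : ℕ) : partialFourier rieszFreq k 1 s =
      ((∫ x in Set.Icc (0 : ℝ) 1, (e x).re * rieszPartialProduct (fun _ => 1) rieszFreq k x : ℝ) : ℂ)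
      + ((∫ x in Set.Icc (0 : ℝ) 1,
          (e x).im * rieszPartialProduct (fun _ => 1) rieszFreq k x : ℝ) : ℂ) * Complex.I := by
    have hi := (continuous_partialFourier_integrand (n := rieszFreq) k s).integrableOn_Icc
      (μ := volume) (a := 0) (b := 1)
    rw [partialFourier, intervalIntegral.integral_of_le zero_le_one, ← integral_Icc_eq_integral_Ioc,
      ← integral_re_add_im hi]
    simp [e, mul_comm]
  simp only [hk]
  rw [measureFourier, ← integral_re_add_im (𝕜 := ℂ) hint]
  refine Tendsto.add ?_ (Tendsto.mul_const _ ?_)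
  · exact (Complex.continuous_ofReal.tendsto _).comp
      (tendsto_integral_rieszPartialProduct (Complex.continuous_re.comp he))
  · exact (Complex.continuous_ofReal.tendsto _).comp
      (tendsto_integral_rieszPartialProduct (Complex.continuous_im.comp he))

theorem measureFourier_rieszMeasure_freq (m : ℕ) :
    measureFourier rieszMeasure (rieszFreq m) = 1 / 2 := by
  refine tendsto_nhds_unique ((tendsto_partialFourier_one _).comp (tendsto_add_atTop_nat (m + 1))) ?_
  refine tendsto_const_nhds.congr fun k => ?_
  rw [Function.comp_apply, add_comm, partialFourier_one_freq four_mul_freqSum_le rieszFreq_pos]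

theorem not_isRajchman_rieszMeasure : ¬ IsRajchman rieszMeasure := by
  rintro ⟨-, h⟩
  have hinj : Function.Injective fun m : ℕ => (rieszFreq m : ℤ) :=
    Nat.cast_injective.comp rieszFreq_strictMono.injective
  have h' := (h.comp hinj.tendsto_cofinite)
  simp only [Function.comp_def, Int.cast_natCast, measureFourier_rieszMeasure_freq] at h'
  have := tendsto_nhds_unique h' tendsto_const_nhds
  norm_num at this

end Limit

/-! ### The multiplier estimate -/

section Multiplier

/-- Lebesgue measure on `[0,1]`. -/
noncomputable def unitMeasure : Measure ℝ := volume.restrict (Set.Icc 0 1)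

instance isProbabilityMeasure_unitMeasure : IsProbabilityMeasure unitMeasure :=
  ⟨by simp [unitMeasure]⟩

theorem ae_unitMeasure_mem_Icc : ∀ᵐ x ∂unitMeasure, x ∈ Set.Icc (0 : ℝ) 1 :=
  ae_restrict_mem measurableSet_Icc

theorem ae_rieszMeasure_mem_Icc : ∀ᵐ x ∂rieszMeasure, x ∈ Set.Icc (0 : ℝ) 1 :=
  rieszMeasure_compl_Icc

theorem measureFourier_unitMeasure (n : ℕ → ℕ) (s : ℝ) :
    measureFourier unitMeasure s = partialFourier n 0 1 s := by
  simp [measureFourier, unitMeasure, partialFourier, rieszPartialProduct,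
    intervalIntegral.integral_of_le, integral_Icc_eq_integral_Ioc]

/-- The difference of the Fourier transforms of the Riesz product measure and of Lebesgue measure
on `[0,1]`. -/
noncomputable def multiplier (s : ℝ) : ℂ :=
  measureFourier rieszMeasure s - measureFourier unitMeasure s

theorem continuous_multiplier : Continuous multiplier :=
  continuous_measureFourier.sub continuous_measureFourier

theorem norm_multiplier_le_two (s : ℝ) : ‖multiplier s‖ ≤ 2 := by
  refine (norm_sub_le _ _).trans ?_
  linarith [norm_measureFourier_le_one (ν := rieszMeasure) s,
    norm_measureFourier_le_one (ν := unitMeasure) s]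

theorem norm_measureFourier_sub_one_le {ν : Measure ℝ} [IsProbabilityMeasure ν]
    (hν : ∀ᵐ x ∂ν, x ∈ Set.Icc (0 : ℝ) 1) (s : ℝ) :
    ‖measureFourier ν s - 1‖ ≤ 2 * Real.pi * |s| := by
  have hint : Integrable (fun x : ℝ =>
      Complex.exp (-2 * (Real.pi : ℂ) * Complex.I * (s : ℂ) * (x : ℂ))) ν :=
    Integrable.of_bound (Continuous.aestronglyMeasurable (by fun_prop)) 1
      (Eventually.of_forall fun x => by simp [Complex.norm_exp])
  have h1 : measureFourier ν s - 1 = ∫ x : ℝ,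
      (Complex.exp (-2 * (Real.pi : ℂ) * Complex.I * (s : ℂ) * (x : ℂ)) - 1) ∂ν := by
    rw [integral_sub hint (integrable_const _)]
    simp [measureFourier]
  rw [h1]
  refine (norm_integral_le_of_norm_le_const (C := 2 * Real.pi * |s|) ?_).trans (by simp)
  filter_upwards [hν] with x hx
  have h2 := Real.norm_exp_I_mul_ofReal_sub_one_le (x := -2 * Real.pi * s * x)
  have h3 : -2 * (Real.pi : ℂ) * Complex.I * (s : ℂ) * (x : ℂ) =
      Complex.I * ((-2 * Real.pi * s * x : ℝ) : ℂ) := by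
    push_cast; ring
  rw [h3]
  refine h2.trans ?_
  have h4 : ‖-2 * Real.pi * s * x‖ = 2 * Real.pi * |s| * x := by
    simp [abs_of_pos Real.pi_pos, abs_of_nonneg hx.1]
  rw [h4]
  exact mul_le_of_le_one_right (by positivity) hx.2

theorem norm_multiplier_le_mul_abs (s : ℝ) : ‖multiplier s‖ ≤ 16 * |s| := by
  have h1 := norm_measureFourier_sub_one_le ae_rieszMeasure_mem_Icc s
  have h2 := norm_measureFourier_sub_one_le ae_unitMeasure_mem_Icc s
  have h3 : multiplier s = (measureFourier rieszMeasure s - 1) -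
      (measureFourier unitMeasure s - 1) := by
    simp [multiplier]
  rw [h3]
  refine (norm_sub_le _ _).trans ?_
  nlinarith [Real.pi_lt_four, abs_nonneg s]

/-- Between two consecutive frequencies, and away from both of them, the multiplier is small. -/
theorem norm_multiplier_le_of_gap {j : ℕ} {s : ℝ} (h1 : 4 * (rieszFreq j : ℝ) ≤ |s|)
    (h2 : 4 * |s| ≤ rieszFreq (j + 1)) : ‖multiplier s‖ ≤ 16 * (1 / 2) ^ j := by
  have hn := sixteen_le_rieszFreq j
  have hpow : (16 : ℝ) ^ (j + 1) ≤ rieszFreq j := by exact_mod_cast pow_succ_le_rieszFreq j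
  have hD := four_mul_freqSum_le j
  have hmono (i : ℕ) : (rieszFreq (j + 1) : ℝ) ≤ rieszFreq (i + (j + 1)) := by
    exact_mod_cast rieszFreq_strictMono.monotone (Nat.le_add_left _ _)
  have hfreq : freqSum rieszFreq (j + 1) ≤ 2 * rieszFreq j := by
    rw [freqSum_succ]; linarith
  have e8 : (2 : ℝ) ^ j / 16 ^ j = (1 / 8) ^ j := by rw [← div_pow]; norm_num
  -- The first `j + 1` factors, whose frequencies have sum at most `|s| / 2`.
  have b1 : ‖partialFourier rieszFreq (j + 1) 1 s‖ ≤ (1 / 8) ^ j := by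
    refine (norm_partialFourier_le (j + 1) 1 (by linarith)).trans ?_
    calc (2 : ℝ) ^ (j + 1) / (|s| - freqSum rieszFreq (j + 1))
        ≤ 2 ^ (j + 1) / (2 * 16 ^ j) :=
          div_le_div_of_nonneg_left (by positivity) (by positivity) (by
            rw [pow_succ] at hpow
            nlinarith [pow_pos (show (0 : ℝ) < 16 by norm_num) j])
      _ = (1 / 8) ^ j := by rw [← e8, pow_succ]; field_simp
  -- The remaining factors, whose frequencies are all at least `4 |s|`.
  have b2 : dist (partialFourier rieszFreq (j + 1) 1 s) (measureFourier rieszMeasure s) ≤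
      (1 / 8) ^ j := by
    have hlim := (tendsto_add_atTop_iff_nat (j + 1)).2 (tendsto_partialFourier_one s)
    have := dist_le_of_le_geometric_of_tendsto₀ (1 / 8) (1 / 4 * (1 / 8) ^ (j + 1)) (by norm_num)
      (f := fun i => partialFourier rieszFreq (i + (j + 1)) 1 s) (fun i => by
        have := dist_partialFourier_succ_le 1 (s := s) (k := i + (j + 1)) (h2.trans (hmono i))
        rw [pow_add, add_right_comm] at this
        refine this.trans (le_of_eq (by ring))) hlim
    rw [zero_add] at this
    refine this.trans ?_
    rw [pow_succ, div_le_iff₀ (by norm_num)]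
    linarith [pow_pos (show (0 : ℝ) < 1 / 8 by norm_num) j]
  have b3 : ‖measureFourier unitMeasure s‖ ≤ (1 / 8) ^ j := by
    have hs : 0 < |s| := by linarith
    rw [measureFourier_unitMeasure rieszFreq]
    refine (norm_partialFourier_zero_le 1 (abs_pos.1 hs)).trans ?_
    rw [← e8, div_le_div_iff₀ hs (by positivity), one_mul]
    have : (1 : ℝ) ≤ 2 ^ j := one_le_pow₀ (by norm_num)
    rw [pow_succ] at hpow
    nlinarith [pow_pos (show (0 : ℝ) < 16 by norm_num) j]
  have b4 : ‖measureFourier rieszMeasure s‖ ≤ 2 * (1 / 8) ^ j := by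
    have := norm_sub_norm_le (measureFourier rieszMeasure s) (partialFourier rieszFreq (j + 1) 1 s)
    rw [dist_comm, dist_eq_norm] at b2
    linarith
  have b5 : ((1 : ℝ) / 8) ^ j ≤ (1 / 2) ^ j := by gcongr; norm_num
  refine (norm_sub_le _ _).trans ?_
  linarith [pow_pos (show (0 : ℝ) < 1 / 2 by norm_num) j]

/-- The contraction ratios `1 / (n k) ^ 2`. -/
noncomputable def ratio (k : ℕ) : ℝ := ((rieszFreq k : ℝ) ^ 2)⁻¹

theorem ratio_pos (k : ℕ) : 0 < ratio k := by
  have := sixteen_le_rieszFreq k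
  unfold ratio; positivity

theorem ratio_le_one (k : ℕ) : ratio k ≤ 1 := by
  have := sixteen_le_rieszFreq k
  exact inv_le_one_of_one_le₀ (by nlinarith)

theorem tendsto_ratio : Tendsto ratio atTop (𝓝 0) := by
  have h : Tendsto (fun k => (rieszFreq k : ℝ)) atTop atTop :=
    tendsto_natCast_atTop_atTop.comp rieszFreq_strictMono.tendsto_atTop
  exact tendsto_inv_atTop_zero.comp ((tendsto_pow_atTop two_ne_zero).comp h)

/-- Of two dilates of a point, at most one is exceptional. If `ratio l * ξ` is not close to `0`, then
`ratio k * ξ` is so large that it can be exceptional only by being close to some `n (m + 1)` with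
`l ≤ m`. Since `ratio k / ratio l` is between `16` and `(n m) ^ 2`, the smaller dilate
`ratio l * ξ` then falls into the gap between `n m` and `n (m + 1)`. -/
theorem norm_multiplier_le_or {k l : ℕ} (hkl : k < l) (ξ : ℝ) :
    ‖multiplier (ratio k * ξ)‖ ≤ 16 * (1 / 2) ^ k ∨
      ‖multiplier (ratio l * ξ)‖ ≤ 16 * (1 / 2) ^ l := by
  by_contra! hcon
  obtain ⟨hk, hl⟩ := hcon
  have nk := sixteen_le_rieszFreq k
  have nl := sixteen_le_rieszFreq l
  set a : ℝ := (rieszFreq k : ℝ)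
  set b : ℝ := (rieszFreq l : ℝ)
  set x : ℝ := |ratio k * ξ| with hx
  have hxl : |ratio l * ξ| = x * a ^ 2 / b ^ 2 := by
    rw [hx, abs_mul, abs_mul, abs_of_pos (ratio_pos k), abs_of_pos (ratio_pos l)]
    simp only [ratio]
    change (b ^ 2)⁻¹ * |ξ| = (a ^ 2)⁻¹ * |ξ| * a ^ 2 / b ^ 2
    field_simp
  have hab : 4 ^ (l + 1) * a ^ 2 ≤ b := by
    have h1 : a ^ 4 ≤ b := by
      have : rieszFreq k ^ 4 ≤ rieszFreq l := by
        rw [← rieszFreq_succ]; exact rieszFreq_strictMono.monotone hkl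
      simp only [a, b]; exact_mod_cast this
    have h2 : (16 : ℝ) ^ (l + 1) ≤ b := by simp only [b]; exact_mod_cast pow_succ_le_rieszFreq l
    refine le_of_sq_le_sq ?_ (by linarith)
    calc (4 ^ (l + 1) * a ^ 2) ^ 2 = (16 : ℝ) ^ (l + 1) * a ^ 4 := by
          rw [mul_pow, ← pow_mul, ← pow_mul, mul_comm (l + 1), pow_mul]; norm_num
      _ ≤ b * b := mul_le_mul h2 h1 (by positivity) (by linarith)
      _ = b ^ 2 := by ring
  have ha : 0 < a := by linarith
  have hb : 0 < b := by linarith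
  have h4b : 4 * b ≤ x := by
    have h1 : (1 / 2) ^ l < x * a ^ 2 / b ^ 2 := by
      have := hl.trans_le (norm_multiplier_le_mul_abs _)
      rw [hxl] at this
      linarith
    have h2 : (1 : ℝ) / 4 ^ l ≤ (1 / 2) ^ l := by
      rw [one_div, ← inv_pow]; gcongr; norm_num
    have h3 := h2.trans_lt h1
    rw [div_lt_div_iff₀ (by positivity) (by positivity), one_mul] at h3
    rw [pow_succ] at hab
    -- `b ^ 2 < 4 ^ l x a ^ 2 ≤ x b / 4`
    have h5 : b * (4 * b) < b * x := by
      have : 0 ≤ x := abs_nonneg _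
      nlinarith
    exact (lt_of_mul_lt_mul_left h5 hb.le).le
  have hex : ∃ p, x < 4 * (rieszFreq p : ℝ) := by
    have h : Tendsto (fun k => (rieszFreq k : ℝ)) atTop atTop :=
      tendsto_natCast_atTop_atTop.comp rieszFreq_strictMono.tendsto_atTop
    obtain ⟨p, hp⟩ := (h.eventually_gt_atTop x).exists
    exact ⟨p, by linarith [sixteen_le_rieszFreq p]⟩
  classical
  obtain ⟨p, hp, hmin⟩ : ∃ p, x < 4 * (rieszFreq p : ℝ) ∧
      ∀ q < p, 4 * (rieszFreq q : ℝ) ≤ x :=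
    ⟨Nat.find hex, Nat.find_spec hex, fun q hq => not_lt.1 (Nat.find_min hex hq)⟩
  have hlp : l < p := by
    by_contra! hpl
    have : (rieszFreq p : ℝ) ≤ b := by
      simp only [b]; exact_mod_cast rieszFreq_strictMono.monotone hpl
    linarith
  obtain ⟨m, rfl⟩ : ∃ m, p = m + 1 := ⟨p - 1, by omega⟩
  have hm := hmin m (by omega)
  have hpow {i : ℕ} (hi : i ≤ m) : (16 : ℝ) * (1 / 2) ^ m ≤ 16 * (1 / 2) ^ i := by
    gcongr ?_ * ?_
    exact pow_le_pow_of_le_one (by norm_num) (by norm_num) hi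
  by_cases hgap : 4 * x ≤ rieszFreq (m + 1)
  · exact absurd ((norm_multiplier_le_of_gap hm hgap).trans (hpow (by omega))) (not_le.2 hk)
  · -- `ratio k * ξ` is close to `n (m + 1)`, so `ratio l * ξ` lies in the gap below it.
    push Not at hgap
    have nm := sixteen_le_rieszFreq m
    have hbm : b ≤ rieszFreq m := by
      simp only [b]; exact_mod_cast rieszFreq_strictMono.monotone (show l ≤ m by omega)
    have hsucc : (rieszFreq (m + 1) : ℝ) = (rieszFreq m : ℝ) ^ 4 := by
      rw [rieszFreq_succ]; push_cast; rfl
    have ha1 : 1 ≤ a ^ 2 := by nlinarith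
    have low : 4 * (rieszFreq m : ℝ) ≤ |ratio l * ξ| := by
      rw [hxl, le_div_iff₀ (by positivity)]
      set c : ℝ := (rieszFreq m : ℝ)
      calc 4 * c * b ^ 2 ≤ 4 * c * c ^ 2 := by gcongr
        _ ≤ c ^ 4 / 4 := by nlinarith [pow_pos (show 0 < c by linarith) 3]
        _ ≤ x := by rw [hsucc] at hgap; linarith
        _ ≤ x * a ^ 2 := le_mul_of_one_le_right (abs_nonneg _) ha1
    have high : 4 * |ratio l * ξ| ≤ rieszFreq (m + 1) := by
      have h4 : 4 * a ^ 2 ≤ b := by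
        refine le_trans ?_ hab
        gcongr
        exact le_self_pow₀ (by norm_num) (by omega)
      have h16 : 16 * a ^ 2 ≤ b ^ 2 := by nlinarith
      rw [hxl, ← mul_div_assoc, div_le_iff₀ (by positivity)]
      have : (0 : ℝ) ≤ rieszFreq (m + 1) := Nat.cast_nonneg _
      calc 4 * (x * a ^ 2) ≤ 4 * (4 * rieszFreq (m + 1) * a ^ 2) := by gcongr
        _ = rieszFreq (m + 1) * (16 * a ^ 2) := by ring
        _ ≤ _ := by gcongr
    exact absurd ((norm_multiplier_le_of_gap low high).trans (hpow (by omega))) (not_le.2 hl)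

/-- The square function of the multipliers is bounded. -/
theorem exists_tsum_enorm_multiplier_sq_le :
    ∃ B : ENNReal, B ≠ ⊤ ∧ ∀ ξ : ℝ, ∑' k, ‖multiplier (ratio k * ξ)‖ₑ ^ 2 ≤ B := by
  have hsum : Summable fun k : ℕ => (16 * (1 / 2 : ℝ) ^ k) ^ 2 := by
    have : (fun k : ℕ => (16 * (1 / 2 : ℝ) ^ k) ^ 2) = fun k => 256 * (1 / 4) ^ k := by
      ext k; rw [mul_pow, ← pow_mul, mul_comm k, pow_mul]; norm_num
    rw [this]
    exact (summable_geometric_of_lt_one (by norm_num) (by norm_num)).mul_left _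
  refine ⟨4 + ∑' k : ℕ, ENNReal.ofReal ((16 * (1 / 2 : ℝ) ^ k) ^ 2),
    ENNReal.add_ne_top.2 ⟨by norm_num, hsum.tsum_ofReal_ne_top⟩, fun ξ => ?_⟩
  obtain ⟨k₀, hk₀⟩ : ∃ k₀, ∀ k ≠ k₀, ‖multiplier (ratio k * ξ)‖ ≤ 16 * (1 / 2) ^ k := by
    by_contra! hcon
    obtain ⟨k, -, hk⟩ := hcon 0
    obtain ⟨l, hlk, hl⟩ := hcon k
    rcases lt_or_gt_of_ne hlk with h | h
    · exact (norm_multiplier_le_or h ξ).elim (not_le.2 hl) (not_le.2 hk)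
    · exact (norm_multiplier_le_or h ξ).elim (not_le.2 hk) (not_le.2 hl)
  calc ∑' k, ‖multiplier (ratio k * ξ)‖ₑ ^ 2
      ≤ ∑' k, ((if k = k₀ then 4 else 0) + ENNReal.ofReal ((16 * (1 / 2 : ℝ) ^ k) ^ 2)) := by
        refine ENNReal.tsum_le_tsum fun k => ?_
        rw [← ofReal_norm, ← ENNReal.ofReal_pow (norm_nonneg _)]
        split_ifs with hk
        · refine le_add_right ?_
          rw [← ENNReal.ofReal_ofNat 4]
          exact ENNReal.ofReal_le_ofReal (by
            nlinarith [norm_multiplier_le_two (ratio k * ξ), norm_nonneg (multiplier (ratio k * ξ))])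
        · rw [zero_add]
          exact ENNReal.ofReal_le_ofReal (pow_le_pow_left₀ (norm_nonneg _) (hk₀ k hk) 2)
    _ = _ := by rw [ENNReal.tsum_add, tsum_ite_eq]

end Multiplier

/-! ### Almost everywhere convergence -/

section Convergence
open FourierTransform

variable {f : ℝ → ℂ}

theorem ae_tendsto_measureConv_sub (hf : Integrable f) (hf2 : MemLp f 2) :
    ∀ᵐ x, Tendsto (fun k => measureConv (contraction (ratio k) rieszMeasure) f x -
      measureConv (contraction (ratio k) unitMeasure) f x) atTop (𝓝 0) := by
  have (k : ℕ) : IsProbabilityMeasure (contraction (ratio k) rieszMeasure) :=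
    isProbabilityMeasure_contraction _
  have (k : ℕ) : IsProbabilityMeasure (contraction (ratio k) unitMeasure) :=
    isProbabilityMeasure_contraction _
  obtain ⟨B, hB, hle⟩ := exists_tsum_enorm_multiplier_sq_le
  have hcont : Continuous (𝓕 f) :=
    VectorFourier.fourierIntegral_continuous Real.continuous_fourierChar
      (by exact continuous_inner) hf
  have hm (k : ℕ) : AEMeasurable (fun x =>
      ‖measureConv (contraction (ratio k) rieszMeasure) f x -
        measureConv (contraction (ratio k) unitMeasure) f x‖ₑ ^ 2) :=
    ((integrable_measureConv hf).sub
      (integrable_measureConv hf)).aestronglyMeasurable.enorm.pow_const 2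
  have hfin : ∫⁻ x, ∑' k, ‖measureConv (contraction (ratio k) rieszMeasure) f x -
      measureConv (contraction (ratio k) unitMeasure) f x‖ₑ ^ 2 ≠ ⊤ := by
    refine ne_top_of_le_ne_top (b := B * ∫⁻ x, ‖f x‖ₑ ^ 2) ?_ ?_
    · have h := eLpNorm_nnreal_pow_eq_lintegral (f := f) (μ := volume) (p := 2) (by norm_num)
      simp only [NNReal.coe_ofNat, ENNReal.coe_ofNat, ENNReal.rpow_ofNat] at h
      rw [← h]
      exact ENNReal.mul_ne_top hB (ENNReal.pow_ne_top hf2.2.ne)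
    · rw [lintegral_tsum hm]
      simp_rw [lintegral_enorm_measureConv_sub_sq hf hf2, measureFourier_contraction]
      change ∑' k, ∫⁻ ξ, ‖multiplier (ratio k * ξ)‖ₑ ^ 2 * ‖𝓕 f ξ‖ₑ ^ 2 ≤ _
      have hm' (k : ℕ) : AEMeasurable fun ξ => ‖multiplier (ratio k * ξ)‖ₑ ^ 2 * ‖𝓕 f ξ‖ₑ ^ 2 :=
        ((continuous_multiplier.comp (continuous_const_mul _)).measurable.enorm.pow_const
          2).aemeasurable.mul (hcont.measurable.enorm.pow_const 2).aemeasurable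
      rw [← lintegral_tsum hm']
      simp_rw [ENNReal.tsum_mul_right]
      calc _ ≤ ∫⁻ ξ, B * ‖𝓕 f ξ‖ₑ ^ 2 := by gcongr with ξ; exact hle ξ
        _ = B * ∫⁻ x, ‖f x‖ₑ ^ 2 := by
          rw [lintegral_const_mul' _ _ hB, lintegral_enorm_fourier_sq hf hf2]
  filter_upwards [ae_lt_top' (AEMeasurable.tsum hm) hfin] with x hx
  have h0 := ENNReal.tendsto_atTop_zero_of_tsum_ne_top hx.ne
  rw [tendsto_zero_iff_enorm_tendsto_zero]
  have h1 := ((ENNReal.continuous_rpow_const (y := 1 / 2)).tendsto 0).comp h0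
  rw [ENNReal.zero_rpow_of_pos (by norm_num)] at h1
  refine h1.congr fun k => ?_
  simp only [Function.comp_apply]
  rw [← ENNReal.rpow_natCast, ← ENNReal.rpow_mul]
  norm_num

/-- Averages over intervals converge by the Lebesgue differentiation theorem. -/
theorem ae_tendsto_measureConv_unitMeasure (hf : Integrable f) :
    ∀ᵐ x, Tendsto (fun k => measureConv (contraction (ratio k) unitMeasure) f x) atTop
      (𝓝 (f x)) := by
  filter_upwards [LocallyIntegrable.ae_hasDerivAt_integral hf.locallyIntegrable] with x hx
  have ht : Tendsto (fun k => -ratio k) atTop (𝓝[≠] 0) := by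
    refine tendsto_nhdsWithin_iff.2 ⟨by simpa using tendsto_ratio.neg, ?_⟩
    exact Eventually.of_forall fun k => neg_ne_zero.2 (ratio_pos k).ne'
  refine ((hx 0).tendsto_slope_zero.comp ht).congr fun k => ?_
  have hr := (ratio_pos k).ne'
  have hemb : MeasurableEmbedding fun y : ℝ => ratio k * y :=
    (Homeomorph.mulLeft₀ _ hr).measurableEmbedding
  rw [measureConv, contraction, hemb.integral_map, unitMeasure, integral_Icc_eq_integral_Ioc,
    ← intervalIntegral.integral_of_le zero_le_one, intervalIntegral.integral_comp_sub_mul _ hr,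
    Function.comp_apply,
    intervalIntegral.integral_interval_sub_left hf.intervalIntegrable hf.intervalIntegrable,
    intervalIntegral.integral_symm]
  simp [sub_eq_add_neg]

theorem ae_contraction_mem_Icc {ν : Measure ℝ} (hν : ∀ᵐ y ∂ν, y ∈ Set.Icc (0 : ℝ) 1) {t : ℝ}
    (h0 : 0 ≤ t) (h1 : t ≤ 1) : ∀ᵐ y ∂(contraction t ν), y ∈ Set.Icc (0 : ℝ) 1 := by
  refine (ae_map_iff (p := (· ∈ Set.Icc (0 : ℝ) 1)) (by fun_prop) measurableSet_Icc).2 ?_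
  filter_upwards [hν] with y hy
  exact ⟨mul_nonneg h0 hy.1, mul_le_one₀ h1 hy.1 hy.2⟩

theorem ae_tendsto_measureConv_rieszMeasure_of_integrable (hf : Integrable f) (hf2 : MemLp f 2) :
    ∀ᵐ x, (∀ k, Integrable (fun y => f (x - y)) (contraction (ratio k) rieszMeasure)) ∧
      Tendsto (fun k => measureConv (contraction (ratio k) rieszMeasure) f x) atTop
        (𝓝 (f x)) := by
  have (k : ℕ) : IsProbabilityMeasure (contraction (ratio k) rieszMeasure) :=
    isProbabilityMeasure_contraction _
  filter_upwards [ae_tendsto_measureConv_sub hf hf2, ae_tendsto_measureConv_unitMeasure hf,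
    ae_all_iff.2 fun k => ae_integrable_comp_sub (ν := contraction (ratio k) rieszMeasure) hf]
    with x h1 h2 h3
  exact ⟨h3, by simpa using h1.add h2⟩

/-- As the measures live on `[0,1]`, the convolutions near a point depend only on the restriction of
`f` to a bounded interval, where `f` is integrable. -/
theorem ae_tendsto_measureConv_rieszMeasure (hf2 : MemLp f 2) :
    ∀ᵐ x, (∀ k, Integrable (fun y => f (x - y)) (contraction (ratio k) rieszMeasure)) ∧
      Tendsto (fun k => measureConv (contraction (ratio k) rieszMeasure) f x) atTop
        (𝓝 (f x)) := by
  let F (R : ℕ) : ℝ → ℂ := (Set.Icc (-R : ℝ) R).indicator f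
  have hF2 (R : ℕ) : MemLp (F R) 2 := hf2.indicator measurableSet_Icc
  have hF (R : ℕ) : Integrable (F R) := by
    rw [integrable_indicator_iff measurableSet_Icc]
    exact (hf2.restrict _).integrable (by norm_num)
  filter_upwards [ae_all_iff.2 fun R : ℕ =>
    ae_tendsto_measureConv_rieszMeasure_of_integrable (hF R) (hF2 R)] with x hx
  obtain ⟨R, hR⟩ := exists_nat_ge (|x| + 1)
  have hx1 := neg_abs_le x
  have hx2 := le_abs_self x
  have heq (y : ℝ) (hy : y ∈ Set.Icc (0 : ℝ) 1) : F R (x - y) = f (x - y) :=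
    Set.indicator_of_mem
      (show x - y ∈ Set.Icc (-R : ℝ) R from ⟨by linarith [hy.2], by linarith [hy.1]⟩) f
  have hae (k : ℕ) : (fun y => F R (x - y)) =ᵐ[contraction (ratio k) rieszMeasure]
      fun y => f (x - y) := by
    filter_upwards [ae_contraction_mem_Icc ae_rieszMeasure_mem_Icc (ratio_pos k).le
      (ratio_le_one k)] with y hy using heq y hy
  obtain ⟨h1, h2⟩ := hx R
  refine ⟨fun k => (h1 k).congr (hae k), ?_⟩
  have e0 := heq 0 (by simp)
  rw [sub_zero] at e0
  rw [e0] at h2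
  exact h2.congr fun k => integral_congr_ae (hae k)

end Convergence

theorem mainTheorem1 :
    ∃ (n : ℕ → ℕ) (μ : Measure ℝ) (t : ℕ → ℝ),
      IsRieszProductMeasure (fun _ => 1) n μ ∧
      (∀ x : ℝ, μ {x} = 0) ∧
      ¬ IsRajchman μ ∧
      (∀ k, 0 < t k) ∧
      Tendsto t atTop (𝓝 0) ∧
      ∀ f : ℝ → ℂ, MemLp f 2 (volume : Measure ℝ) →
        ∀ᵐ x ∂(volume : Measure ℝ),
          (∀ k, Integrable (fun y : ℝ => f (x - y)) (contraction (t k) μ)) ∧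
          Tendsto (fun k => measureConv (contraction (t k) μ) f x) atTop (𝓝 (f x)) :=
  ⟨rieszFreq, rieszMeasure, ratio, isRieszProductMeasure_rieszMeasure, rieszMeasure_singleton,
    not_isRajchman_rieszMeasure, ratio_pos, tendsto_ratio,
    fun _ hf => ae_tendsto_measureConv_rieszMeasure hf⟩
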